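/- Let $K$ be a field of characteristic zero (for instance $K=\mathbb{Q}$) and let $r\ge 0$ be an integer. Consider the functional equation $$ P=\frac{1}{1-\bar z}+\frac{xP}{\bar z^{\,r}}\Bigl(P-\sum_{i=0}^{r}p_i\bar z^{\,i}\Bigr) \qquad (*) $$ for a formal power series $P=\sum_{k\ge 0}p_k\bar z^{\,k}\in K[[x]][[\bar z]]$, where $p_k\in K[[x]]$ is the coefficient of $\bar z^{\,k}$ in $P$. There is exactly one formal power series $y\in K[[x]]$ such that $$ x=\frac{y}{(1+y)^{2r+1}} . $$ Equation $(*)$ has exactly one solution $P\in K[[x]][[\bar z]]$, and this solution is $$ P=\Bigl(1+\frac{t}{y(1+y)}\Bigr)\,\frac{c(t)\,(1+y)^{r+1}}{(1+y\,c(t))^{r+1}}, \qquad t=y(1+y)\,\frac{\bar z}{1-\bar z}, $$ where $c(t)=\dfrac{1-\sqrt{1-4t}}{2t}=\sum_{n\ge 0}\dfrac{1}{n+1}\dbinom{2n}{n}t^n$ is the generating function of the Catalan numbers. -/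

import Mathlib

open scoped PowerSeries

namespace StackSort

noncomputable section

/-- Formal power series in the two variables `x`, `z̄`, as power series in `z̄` whose coefficients
are power series in `x`. -/
abbrev Series2 (K : Type*) [Field K] : Type _ := PowerSeries (PowerSeries K)

/-- The field of fractions of the ring of power series in `x`, `z̄`; the quotients in the
functional equation and in its solution are formed here. -/
abbrev Frac2 (K : Type*) [Field K] : Type _ := FractionRing (Series2 K)

/-- A power series in `x`, `z̄` as an element of the fraction field. -/
abbrev toFrac {K : Type*} [Field K] (A : Series2 K) : Frac2 K :=
  algebraMap (Series2 K) (Frac2 K) A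

/-- A power series in `x` alone as an element of the fraction field. -/
abbrev ofX {K : Type*} [Field K] (a : PowerSeries K) : Frac2 K :=
  toFrac (PowerSeries.C a)

/-- The variable `x` in the fraction field. -/
abbrev xVar (K : Type*) [Field K] : Frac2 K := ofX PowerSeries.X

/-- The variable `z̄` in the fraction field. -/
abbrev zVar (K : Type*) [Field K] : Frac2 K := toFrac PowerSeries.X

/-- The functional equation
`P = 1 / (1 - z̄) + (x P / z̄ ^ r) (P - ∑_{i=0}^r p_i z̄ ^ i)`,
where `p_i`, a power series in `x`, is the coefficient of `z̄ ^ i` in `P`. -/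
def FunctionalEquation {K : Type*} [Field K] (r : ℕ) (P : Series2 K) : Prop :=
  toFrac P = 1 / (1 - zVar K) +
    xVar K * toFrac P / zVar K ^ r *
      (toFrac P - ∑ i ∈ Finset.range (r + 1), ofX (PowerSeries.coeff i P) * zVar K ^ i)

/-- The relation `x = y / (1 + y) ^ (2 r + 1)` for a power series `y` in `x`. The inverse is the
one of formal power series; it is `0` when the constant coefficient of `1 + y` is `0`, and then
the relation fails. -/
def IsY {K : Type*} [Field K] (r : ℕ) (y : PowerSeries K) : Prop :=
  (PowerSeries.X : PowerSeries K) = y * ((1 + y) ^ (2 * r + 1))⁻¹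

/-- The power series `t = y (1 + y) z̄ / (1 - z̄)`, where `1 / (1 - z̄) = ∑ z̄ ^ n`. -/
def tSeries {K : Type*} [Field K] (y : PowerSeries K) : Series2 K :=
  PowerSeries.C (y * (1 + y)) * (PowerSeries.X * PowerSeries.mk 1)

/-- The generating function `c` of the Catalan numbers. -/
def catalanGF (K : Type*) [Field K] : PowerSeries K :=
  PowerSeries.catalanSeries.map (Nat.castRingHom K)

/-- The composition `c(t)` with `t = y (1 + y) z̄ / (1 - z̄)`, a power series in `x`, `z̄`. -/
def catalanT {K : Type*} [Field K] (y : PowerSeries K) : Series2 K :=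
  (catalanGF K).subst (tSeries y)

/-- The right-hand side `(1 + t / (y (1 + y))) · c(t) (1 + y) ^ (r+1) / (1 + y c(t)) ^ (r+1)`. -/
def solutionFormula {K : Type*} [Field K] (r : ℕ) (y : PowerSeries K) : Frac2 K :=
  (1 + toFrac (tSeries y) / (ofX y * (1 + ofX y))) *
    (toFrac (catalanT y) * (1 + ofX y) ^ (r + 1) /
      (1 + ofX y * toFrac (catalanT y)) ^ (r + 1))

/-- `t` is indeed `y (1 + y) z̄ / (1 - z̄)`. -/
theorem tSeries_mul_one_sub {K : Type*} [Field K] (y : PowerSeries K) :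
    tSeries y * (1 - PowerSeries.X) = PowerSeries.C (y * (1 + y)) * PowerSeries.X := by
  rw [tSeries, mul_assoc, mul_assoc, PowerSeries.mk_one_mul_one_sub_eq_one, mul_one]

/-- `t` may be substituted into a power series. -/
theorem hasSubst_tSeries {K : Type*} [Field K] (y : PowerSeries K) :
    PowerSeries.HasSubst (tSeries y) :=
  PowerSeries.HasSubst.of_constantCoeff_zero' (by simp [tSeries])

/-- `c(t)` satisfies `t c(t)² - c(t) + 1 = 0`. -/
theorem catalanT_eq {K : Type*} [Field K] (y : PowerSeries K) :
    tSeries y * catalanT y ^ 2 - catalanT y + 1 = 0 := by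
  have h0 : catalanGF K ^ 2 * PowerSeries.X + 1 = catalanGF K := by
    have := congrArg (PowerSeries.map (Nat.castRingHom K))
      PowerSeries.catalanSeries_sq_mul_X_add_one
    simpa [catalanGF] using this
  have h := congrArg (PowerSeries.substAlgHom (hasSubst_tSeries y)) h0
  rw [map_add, map_mul, map_pow, map_one, PowerSeries.coe_substAlgHom,
    PowerSeries.subst_X (hasSubst_tSeries y)] at h
  change catalanT y ^ 2 * tSeries y + 1 = catalanT y at h
  linear_combination h

end

end StackSort

open scoped PowerSeries

namespace StackSort

/-! ### Contractions and polynomials in a power series ring -/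

section General

variable {R : Type*} [CommRing R]

/-! Write z for z̄, S = 1/(1 - z), T for the truncation of P at degree r. Both uniqueness claims
hold because the factor x makes the equation contract `x`-adically. For existence, let P be the
formula and N = S/P. Cancelling P turns the equation into x P + z^r N = x T + z^r. As N has constant
term 1 in z, this says exactly that the left side has degree at most r in z. Put α = 1/(1 + y c) and
let c' be the other root of t c² - c + 1 = 0. Then (1 + y c)(1 + y c') = 1/z, so β = z (1 + y c) is
the conjugate of α. The relation between x and y makes (1 + y)^(r+1) (x P + z^r N) equal to (y + t
c) α^r + (y + t c') β^r. This is symmetric, with α β = z and α + β linear in z, so a two-term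
recurrence bounds its degree (`isPolyOfDegreeLE_pow_comb`). -/

theorem eq_zero_of_forall_X_pow_dvd {a : R⟦X⟧} (h : ∀ m : ℕ, PowerSeries.X ^ m ∣ a) : a = 0 := by
  ext n
  simpa using PowerSeries.X_pow_dvd_iff.1 (h (n + 1)) n (Nat.lt_succ_self n)

/-- An `X`-adically contracting self-map of a power series ring has exactly one fixed point. -/
theorem existsUnique_fixedPoint_of_contracting (F : R⟦X⟧ → R⟦X⟧)
    (hF : ∀ (m : ℕ) (a b : R⟦X⟧), PowerSeries.X ^ m ∣ a - b →
      PowerSeries.X ^ (m + 1) ∣ F a - F b) :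
    ∃! y, F y = y := by
  have hstep : ∀ n : ℕ, (PowerSeries.X : R⟦X⟧) ^ n ∣ F^[n + 1] 0 - F^[n] 0 := by
    intro n
    induction n with
    | zero => simp
    | succ n ih =>
      rw [Function.iterate_succ_apply' F (n + 1), Function.iterate_succ_apply' F n]
      exact hF _ _ _ (by rwa [Function.iterate_succ_apply' F n] at ih)
  have hmono : ∀ n k : ℕ, (PowerSeries.X : R⟦X⟧) ^ n ∣ F^[n + k] 0 - F^[n] 0 := by
    intro n k
    induction k with
    | zero => simp
    | succ k ih =>
      have h := dvd_add ((pow_dvd_pow _ (Nat.le_add_right n k)).trans (hstep (n + k))) ih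
      rwa [sub_add_sub_cancel] at h
  -- The limit of the iterates: coefficient n is stable from iterate n + 1 on.
  let y : R⟦X⟧ := PowerSeries.mk fun n => PowerSeries.coeff n (F^[n + 1] 0)
  have hy : ∀ n : ℕ, PowerSeries.X ^ n ∣ y - F^[n] 0 := by
    intro n
    rw [PowerSeries.X_pow_dvd_iff]
    intro k hk
    obtain ⟨j, rfl⟩ := Nat.exists_eq_add_of_le (Nat.succ_le_of_lt hk)
    have h := PowerSeries.X_pow_dvd_iff.1 (hmono (k + 1) j) k (Nat.lt_succ_self k)
    rw [map_sub, sub_eq_zero] at h ⊢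
    rw [PowerSeries.coeff_mk]
    exact h.symm
  have hfix : F y = y := by
    refine sub_eq_zero.1 (eq_zero_of_forall_X_pow_dvd fun m => ?_)
    have h := dvd_sub (hF m _ _ (hy m)) (hy (m + 1))
    rw [Function.iterate_succ_apply' F m, sub_sub_sub_cancel_right] at h
    exact (pow_dvd_pow _ (Nat.le_succ m)).trans h
  refine ⟨y, hfix, fun w hw => sub_eq_zero.1 (eq_zero_of_forall_X_pow_dvd fun m => ?_)⟩
  induction m with
  | zero => simp
  | succ m ih => simpa only [hw, hfix] using hF m _ _ ih

/-- The power series that are polynomials of degree at most `d`. -/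
def IsPolyOfDegreeLE (d : ℕ) (f : R⟦X⟧) : Prop :=
  ∀ n, d < n → PowerSeries.coeff n f = 0

theorem IsPolyOfDegreeLE.mono {d e : ℕ} {f : R⟦X⟧} (hf : IsPolyOfDegreeLE d f) (h : d ≤ e) :
    IsPolyOfDegreeLE e f :=
  fun n hn => hf n (h.trans_lt hn)

theorem IsPolyOfDegreeLE.sub {d : ℕ} {f g : R⟦X⟧} (hf : IsPolyOfDegreeLE d f)
    (hg : IsPolyOfDegreeLE d g) : IsPolyOfDegreeLE d (f - g) :=
  fun n hn => by rw [map_sub, hf n hn, hg n hn, sub_zero]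

theorem IsPolyOfDegreeLE.C_mul {d : ℕ} {f : R⟦X⟧} (hf : IsPolyOfDegreeLE d f) (a : R) :
    IsPolyOfDegreeLE d (PowerSeries.C a * f) :=
  fun n hn => by rw [PowerSeries.coeff_C_mul, hf n hn, mul_zero]

theorem IsPolyOfDegreeLE.mul {d e : ℕ} {f g : R⟦X⟧} (hf : IsPolyOfDegreeLE d f)
    (hg : IsPolyOfDegreeLE e g) : IsPolyOfDegreeLE (d + e) (f * g) := by
  intro n hn
  rw [PowerSeries.coeff_mul]
  refine Finset.sum_eq_zero fun p hp => ?_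
  rw [Finset.HasAntidiagonal.mem_antidiagonal] at hp
  rcases lt_or_ge d p.1 with h | h
  · rw [hf _ h, zero_mul]
  · rw [hg p.2 (by omega), mul_zero]

theorem isPolyOfDegreeLE_C (a : R) : IsPolyOfDegreeLE 0 (PowerSeries.C a) :=
  fun n hn => by rw [PowerSeries.coeff_C, if_neg hn.ne']

theorem isPolyOfDegreeLE_linear (a b : R) :
    IsPolyOfDegreeLE 1 (PowerSeries.C a + PowerSeries.C b * PowerSeries.X) := by
  intro n hn
  rw [map_add, PowerSeries.coeff_C_mul, PowerSeries.coeff_C, PowerSeries.coeff_X,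
    if_neg (by omega), if_neg (by omega), mul_zero, add_zero]

/-- The truncation of a power series as a power series. -/
noncomputable def truncLE (r : ℕ) (P : R⟦X⟧) : R⟦X⟧ :=
  ∑ i ∈ Finset.range (r + 1), PowerSeries.C (PowerSeries.coeff i P) * PowerSeries.X ^ i

theorem coeff_truncLE (r n : ℕ) (P : R⟦X⟧) :
    PowerSeries.coeff n (truncLE r P) = if n ≤ r then PowerSeries.coeff n P else 0 := by
  simp [truncLE, PowerSeries.coeff_X_pow]

/-- Symmetric combinations of powers of two series whose sum is linear and whose product is the
variable are polynomials of the expected degree. -/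
theorem isPolyOfDegreeLE_pow_comb {α β p q : R⟦X⟧} {a b a₀ a₁ b₁ : R}
    (hsum : α + β = PowerSeries.C a + PowerSeries.C b * PowerSeries.X)
    (hmul : α * β = PowerSeries.X) (h0 : p + q = PowerSeries.C a₀)
    (h1 : p * α + q * β = PowerSeries.C a₁ + PowerSeries.C b₁ * PowerSeries.X) (n : ℕ) :
    IsPolyOfDegreeLE n (p * α ^ n + q * β ^ n) := by
  induction n using Nat.twoStepInduction with
  | zero => simpa [h0] using isPolyOfDegreeLE_C a₀
  | one => simpa [h1] using isPolyOfDegreeLE_linear a₁ b₁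
  | more n ih0 ih1 =>
    have hX : IsPolyOfDegreeLE 1 (PowerSeries.X : R⟦X⟧) := by
      simpa using isPolyOfDegreeLE_linear (0 : R) 1
    -- α and β are the roots of T² - (α + β) T + α β.
    have key : p * α ^ (n + 2) + q * β ^ (n + 2) =
        (PowerSeries.C a + PowerSeries.C b * PowerSeries.X) * (p * α ^ (n + 1) + q * β ^ (n + 1))
          - PowerSeries.X * (p * α ^ n + q * β ^ n) := by
      rw [← hsum, ← hmul]; ring
    rw [key]
    exact (((isPolyOfDegreeLE_linear a b).mul ih1).mono (by omega)).sub
      ((hX.mul ih0).mono (by omega))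

end General

variable {K : Type*} [Field K]

/-! ### The series `y`, and the functional equation without denominators -/

theorem isY_iff (r : ℕ) (y : K⟦X⟧) :
    IsY r y ↔ PowerSeries.X * (1 + y) ^ (2 * r + 1) = y := by
  unfold IsY
  have hinv (h : PowerSeries.constantCoeff (1 + y) ≠ 0) :
      (1 + y) ^ (2 * r + 1) * ((1 + y) ^ (2 * r + 1))⁻¹ = 1 :=
    PowerSeries.mul_inv_cancel _ (by rw [map_pow]; exact pow_ne_zero _ h)
  constructor
  · intro h
    have h1 : PowerSeries.constantCoeff (1 + y) ≠ 0 := by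
      intro h0
      have : ((1 + y) ^ (2 * r + 1))⁻¹ = 0 := by
        rw [PowerSeries.inv_eq_zero, map_pow, h0, zero_pow (by omega)]
      rw [this, mul_zero] at h
      exact PowerSeries.X_ne_zero h
    linear_combination (1 + y) ^ (2 * r + 1) * h + y * hinv h1
  · intro h
    have h0 : PowerSeries.constantCoeff y = 0 := by rw [← h]; simp
    have h1 : PowerSeries.constantCoeff (1 + y) ≠ 0 := by simp [h0]
    linear_combination ((1 + y) ^ (2 * r + 1))⁻¹ * h - PowerSeries.X * hinv h1

theorem existsUnique_isY (K : Type*) [Field K] (r : ℕ) : ∃! y : K⟦X⟧, IsY r y := by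
  simp_rw [isY_iff]
  refine existsUnique_fixedPoint_of_contracting _ fun m a b h => ?_
  rw [← mul_sub, pow_succ']
  refine mul_dvd_mul_left _ (h.trans ?_)
  simpa using sub_dvd_pow_sub_pow (1 + a) (1 + b) (2 * r + 1)

theorem toFrac_injective : Function.Injective (toFrac : Series2 K → Frac2 K) :=
  IsFractionRing.injective _ _

theorem one_sub_zVar_ne_zero : (1 - zVar K : Frac2 K) ≠ 0 := by
  intro h
  have h1 : (1 - PowerSeries.X : Series2 K) = 0 := toFrac_injective (by simpa using h)
  simpa using congrArg PowerSeries.constantCoeff h1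

theorem toFrac_mk_one : toFrac (PowerSeries.mk 1 : Series2 K) = 1 / (1 - zVar K) := by
  rw [eq_div_iff one_sub_zVar_ne_zero]
  simpa using congrArg toFrac (PowerSeries.mk_one_mul_one_sub_eq_one (K⟦X⟧))

/-- The functional equation with cleared denominators. -/
theorem functionalEquation_iff (r : ℕ) (P : Series2 K) :
    FunctionalEquation r P ↔
      PowerSeries.X ^ r * P = PowerSeries.X ^ r * PowerSeries.mk 1 +
        PowerSeries.C PowerSeries.X * (P * (P - truncLE r P)) := by
  have hz : zVar K ^ r ≠ 0 := by
    refine pow_ne_zero _ fun h => ?_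
    exact PowerSeries.X_ne_zero (toFrac_injective (h.trans (map_zero _).symm))
  unfold FunctionalEquation
  rw [← toFrac_mk_one, ← toFrac_injective.eq_iff, ← mul_right_inj' hz]
  have hQ : toFrac (truncLE r P) =
      ∑ i ∈ Finset.range (r + 1), ofX (PowerSeries.coeff i P) * zVar K ^ i := by
    simp [truncLE]
  rw [← hQ]
  have : zVar K ^ r * (toFrac (PowerSeries.mk 1) + xVar K * toFrac P / zVar K ^ r *
      (toFrac P - toFrac (truncLE r P))) = zVar K ^ r * toFrac (PowerSeries.mk 1) +
      xVar K * (toFrac P * (toFrac P - toFrac (truncLE r P))) := by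
    field_simp
  rw [this]
  simp only [toFrac, map_mul, map_add, map_sub, map_pow]

/-- Coefficient n of P modulo x^(m+1) depends on coefficients up to n + r modulo x^m, so the
induction on m must treat all n at once. -/
theorem functionalEquation_unique {r : ℕ} {P P' : Series2 K} (h : FunctionalEquation r P)
    (h' : FunctionalEquation r P') : P = P' := by
  rw [functionalEquation_iff] at h h'
  suffices H : ∀ m n : ℕ, PowerSeries.X ^ m ∣ PowerSeries.coeff n P - PowerSeries.coeff n P' by
    ext1 n
    exact sub_eq_zero.1 (eq_zero_of_forall_X_pow_dvd fun m => H m n)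
  intro m
  induction m with
  | zero => simp
  | succ m ih =>
    intro n
    have e := congrArg (PowerSeries.coeff (n + r)) h
    have e' := congrArg (PowerSeries.coeff (n + r)) h'
    simp only [map_add, PowerSeries.coeff_X_pow_mul, PowerSeries.coeff_C_mul] at e e'
    rw [e, e', add_sub_add_left_eq_sub, ← mul_sub, pow_succ']
    refine mul_dvd_mul_left _ ?_
    rw [PowerSeries.coeff_mul, PowerSeries.coeff_mul, ← Finset.sum_sub_distrib]
    refine Finset.dvd_sum fun p _ => ?_
    rw [map_sub, map_sub, coeff_truncLE, coeff_truncLE]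
    split_ifs
    · simp
    · have e2 : ∀ a b a' b' : K⟦X⟧, a * (b - 0) - a' * (b' - 0) = a * (b - b') + (a - a') * b' := by
        intros; ring
      rw [e2]
      exact dvd_add ((ih _).mul_left _) ((ih _).mul_right _)

/-- The formula in terms of `y` is a power series and solves the functional equation. -/
theorem exists_solution {r : ℕ} {y : K⟦X⟧} (hy : IsY r y) :
    ∃ P : Series2 K, FunctionalEquation r P ∧ toFrac P = solutionFormula r y := by
  rw [isY_iff] at hy
  have hy0 : PowerSeries.constantCoeff y = 0 := by rw [← hy]; simp
  have hy1 : (1 + y) * (1 + y)⁻¹ = 1 := PowerSeries.mul_inv_cancel _ (by simp [hy0])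
  have hyne : y ≠ 0 := by
    rintro rfl
    simp at hy
  have hyne' : 1 + y ≠ 0 := left_ne_zero_of_mul_eq_one hy1
  obtain ⟨k, hk⟩ : ∃ k, k = (1 + y)⁻¹ := ⟨_, rfl⟩
  rw [← hk] at hy1
  obtain ⟨Y, hY⟩ : ∃ Y : Series2 K, Y = PowerSeries.C y := ⟨_, rfl⟩
  obtain ⟨h, hh⟩ : ∃ h : Series2 K, h = PowerSeries.C k := ⟨_, rfl⟩
  obtain ⟨x, hx⟩ : ∃ x : Series2 K, x = PowerSeries.C PowerSeries.X := ⟨_, rfl⟩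
  obtain ⟨z, hz⟩ : ∃ z : Series2 K, z = PowerSeries.X := ⟨_, rfl⟩
  obtain ⟨S, hS⟩ : ∃ S : Series2 K, S = PowerSeries.mk 1 := ⟨_, rfl⟩
  obtain ⟨t, ht⟩ : ∃ t : Series2 K, t = tSeries y := ⟨_, rfl⟩
  obtain ⟨c, hc⟩ : ∃ c : Series2 K, c = catalanT y := ⟨_, rfl⟩
  have hYh : (1 + Y) * h = 1 := by
    rw [hY, hh, ← map_one PowerSeries.C, ← map_add, ← map_mul, hy1]
  have hxY : x * (1 + Y) ^ (2 * r + 1) = Y := by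
    rw [hY, hx, ← map_one PowerSeries.C, ← map_add, ← map_pow, ← map_mul, hy]
  have hSz : S * (1 - z) = 1 := by
    rw [hS, hz]; exact PowerSeries.mk_one_mul_one_sub_eq_one _
  have htS : t = Y * (1 + Y) * (z * S) := by
    rw [ht, tSeries, hY, hz, hS, map_mul, map_add, map_one]
  have hcat : t * c ^ 2 - c + 1 = 0 := by rw [ht, hc]; exact catalanT_eq y
  have htz : t * (1 - z) = Y * (1 + Y) * z := by
    rw [htS]; linear_combination Y * (1 + Y) * z * hSz
  have ht0 : PowerSeries.constantCoeff t = 0 := by rw [htS, hz]; simp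
  have hc0 : PowerSeries.constantCoeff c = 1 := by
    have := congrArg PowerSeries.constantCoeff hcat
    simp [ht0] at this
    linear_combination -this
  have haunit : IsUnit (1 + Y * c) := by
    rw [PowerSeries.isUnit_iff_constantCoeff, hY]
    simp [hc0, PowerSeries.isUnit_iff_constantCoeff, hy0]
  obtain ⟨α, hα⟩ := haunit.exists_right_inv
  have hβsum : α + z * (1 + Y * c) = PowerSeries.C k +
      PowerSeries.C (2 - k) * PowerSeries.X := by
    rw [map_sub, ← hh, ← hz, map_ofNat]
    have e : (1 + Y) * (1 + z * (1 + Y * c) ^ 2) =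
        (1 + Y * c) * (1 - z + 2 * z * (1 + Y)) := by
      linear_combination Y * (1 - z) * hcat - Y * c ^ 2 * htz
    linear_combination h * α * e + (1 - z + 2 * z * (1 + Y)) * h * hα
      - (α + z * (1 + Y * c)) * hYh - (1 + Y) * h * z * (1 + Y * c) * hα + 2 * z * hYh
  have hβmul : α * (z * (1 + Y * c)) = PowerSeries.X := by
    rw [← hz]; linear_combination z * hα
  -- Conjugation exchanges t c and 1 - t c, hence these two weights.
  have hpq : (Y + t * c) + (Y + (1 - t * c)) = PowerSeries.C (1 + 2 * y) := by
    simp only [hY, map_add, map_mul, map_one, map_ofNat]; ring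
  have hlin : (Y + t * c) * α + (Y + (1 - t * c)) * (z * (1 + Y * c)) =
      PowerSeries.C (1 - k) + PowerSeries.C (4 * y + k) * PowerSeries.X := by
    rw [map_sub, map_add, map_mul, map_one, map_ofNat, ← hh, ← hz, ← hY]
    have e : (1 + Y) * ((Y + t * c) + (Y + (1 - t * c)) * z * (1 + Y * c) ^ 2) =
        (1 + Y * c) * (Y + (2 * Y + 1) ^ 2 * z) := by
      linear_combination (Y ^ 2 * (1 - z) - (1 + Y) * z * (2 * Y + Y ^ 2 * c)) * hcat +
        ((1 + Y) * c - Y ^ 2 * c ^ 2) * htz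
    linear_combination h * α * e + h * (Y + (2 * Y + 1) ^ 2 * z) * hα - (Y + t * c) * α * hYh
      - (Y + (1 - t * c)) * z * (1 + Y * c) * (h * (1 + Y) * hα + hYh) + (1 + 4 * Y * z) * hYh
  have hpoly := isPolyOfDegreeLE_pow_comb hβsum hβmul hpq hlin r
  obtain ⟨P, hP⟩ : ∃ P : Series2 K, P = S * c * (1 + Y) ^ (r + 1) * α ^ (r + 1) := ⟨_, rfl⟩
  obtain ⟨N, hN⟩ : ∃ N : Series2 K, N = (1 - t * c) * (1 + Y * c) ^ (r + 1) * h ^ (r + 1) :=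
    ⟨_, rfl⟩
  have huc : (1 - t * c) * c = 1 := by linear_combination -hcat
  have hNP : N * P = S := by
    have e : N * P = S * ((1 - t * c) * c) * ((1 + Y) * h) ^ (r + 1) *
        ((1 + Y * c) * α) ^ (r + 1) := by
      rw [hN, hP, mul_pow _ h, mul_pow _ α]; ring
    rw [e, huc, hYh, hα]; ring
  have hN0 : PowerSeries.constantCoeff N = 1 := by
    have e : PowerSeries.constantCoeff N =
        (PowerSeries.constantCoeff ((1 + Y) * h)) ^ (r + 1) := by
      rw [hN]
      simp [ht0, hc0, mul_pow]
    rw [e, hYh]; simp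
  have hsum : x * P + z ^ r * N = h ^ (r + 1) *
      ((Y + t * c) * α ^ r + (Y + (1 - t * c)) * (z * (1 + Y * c)) ^ r) := by
    have e1 : (Y * (1 + Y)) * S * c * α = Y + t * c := by
      have e : (Y * (1 + Y)) * S * c = (Y + t * c) * (1 + Y * c) := by
        have : (Y * (1 + Y)) * S = Y * (1 + Y) + t := by
          rw [htS]; linear_combination Y * (1 + Y) * hSz
        rw [this]; linear_combination -Y * hcat
      rw [e]; linear_combination (Y + t * c) * hα
    -- The only use in this identity of x = y / (1 + y)^(2r+1).
    have e2 : x * (1 + Y) ^ (r + 1) = h ^ (r + 1) * (Y * (1 + Y)) := by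
      have e3 : h ^ (r + 1) * (1 + Y) ^ (r + 1) = 1 := by rw [← mul_pow, mul_comm, hYh, one_pow]
      linear_combination (-(x * (1 + Y) ^ (r + 1))) * e3 + h ^ (r + 1) * (1 + Y) * hxY
    have e5 : x * P = h ^ (r + 1) * ((Y + t * c) * α ^ r) := by
      rw [hP, ← e1]
      linear_combination S * c * α ^ (r + 1) * e2
    rw [e5, hN, mul_pow z]
    linear_combination z ^ r * h ^ (r + 1) * (1 + Y * c) ^ r * Y * huc
  have hk_pow : h ^ (r + 1) = PowerSeries.C (k ^ (r + 1)) := by rw [hh, map_pow]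
  have hG : IsPolyOfDegreeLE r (x * P + z ^ r * N) := by
    rw [hsum, hk_pow]
    exact hpoly.C_mul _
  have hG' : x * P + z ^ r * N = x * truncLE r P + z ^ r := by
    ext1 n
    rcases lt_or_ge r n with hn | hn
    · rw [hG n hn, map_add, hx, PowerSeries.coeff_C_mul, coeff_truncLE, if_neg (by omega), hz,
        PowerSeries.coeff_X_pow, if_neg hn.ne', mul_zero, add_zero]
    · rw [map_add, map_add, hx, PowerSeries.coeff_C_mul, PowerSeries.coeff_C_mul, coeff_truncLE,
        if_pos hn, hz, PowerSeries.coeff_X_pow, PowerSeries.coeff_X_pow_mul']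
      congr 1
      rcases hn.eq_or_lt with rfl | hlt
      -- In degree r, the constant term 1 of N supplies the z^r on the right.
      · simp [hN0]
      · rw [if_neg (by omega), if_neg (by omega)]
  refine ⟨P, ?_, ?_⟩
  · rw [functionalEquation_iff, ← hx, ← hz, ← hS]
    linear_combination (-P) * hG' + z ^ r * hNP
  · have f1 : (1 + ofX y : Frac2 K) ≠ 0 := by
      intro h0
      refine hyne' (PowerSeries.C_injective (toFrac_injective ?_))
      simpa using h0
    have f2 : (ofX y : Frac2 K) ≠ 0 := by
      intro h0
      refine hyne (PowerSeries.C_injective (toFrac_injective ?_))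
      simpa using h0
    have f3 : (1 + ofX y * toFrac c) * toFrac α = 1 := by
      have := congrArg toFrac hα
      simpa [hY] using this
    have f4 : 1 + ofX y * toFrac c ≠ 0 := left_ne_zero_of_mul_eq_one f3
    have f5 : toFrac t / (ofX y * (1 + ofX y)) = toFrac z * toFrac S := by
      rw [div_eq_iff (mul_ne_zero f2 f1), htS, hY]
      simp only [toFrac, map_mul, map_add, map_one]
      ring
    have f6 : 1 + toFrac z * toFrac S = toFrac S := by
      have := congrArg toFrac hSz
      simp only [toFrac, map_mul, map_sub, map_one] at this ⊢
      linear_combination -this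
    unfold solutionFormula
    rw [← ht, ← hc, f5, f6, hP, eq_comm, ← mul_div_assoc, div_eq_iff (pow_ne_zero _ f4), hY]
    simp only [toFrac, map_mul, map_pow, map_add, map_one] at f3 ⊢
    have f7 := congrArg (· ^ (r + 1)) f3
    simp only [mul_pow, one_pow] at f7
    linear_combination (-(toFrac S * toFrac c * (1 + ofX y) ^ (r + 1))) * f7

end StackSort

theorem mainTheorem8 (K : Type*) [Field K] [CharZero K] (r : ℕ) :
    (∃! y : PowerSeries K, StackSort.IsY r y) ∧
    (∃! P : StackSort.Series2 K, StackSort.FunctionalEquation r P) ∧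
    ∀ (y : PowerSeries K), StackSort.IsY r y → ∀ P : StackSort.Series2 K,
      (StackSort.FunctionalEquation r P ↔
        StackSort.toFrac P = StackSort.solutionFormula r y) := by
  refine ⟨StackSort.existsUnique_isY K r, ?_, fun y hy P => ?_⟩
  · obtain ⟨y, hy, -⟩ := StackSort.existsUnique_isY K r
    obtain ⟨P, hP, -⟩ := StackSort.exists_solution hy
    exact ⟨P, hP, fun Q hQ => StackSort.functionalEquation_unique hQ hP⟩
  · obtain ⟨P₀, hP₀, hformula⟩ := StackSort.exists_solution hy
    rw [← hformula, StackSort.toFrac_injective.eq_iff]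
    exact ⟨fun h => StackSort.functionalEquation_unique h hP₀, fun h => h ▸ hP₀⟩
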